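/- Let $r^1,\ldots,r^n\in\mathbb{Z}^n$ satisfy $6\le|\det(r^1,\ldots,r^n)|\le n$, and let $C=\operatorname{pos}\{r^1,\ldots,r^n\}\subseteq\mathbb{R}^n$ be the cone of all non-negative real combinations of $r^1,\ldots,r^n$. Then $$\operatorname{ICR}(C)\le n+|\det(r^1,\ldots,r^n)|-3 .$$ Here the integer Carathéodory rank of a pointed rational cone $C$ is $$\operatorname{ICR}(C)=\max_{z\in C\cap\mathbb{Z}^n}\min\Big\{k : z=\sum_{i=1}^k\lambda_i h^i \text{ with } \lambda_i\in\mathbb{Z}_{\ge 0} \text{ and } h^i\in\mathcal{H}(C) \text{ for all } i\Big\},$$ and the Hilbert basis $\mathcal{H}(C)$ is the smallest (with respect to inclusion) set of integer vectors in $C$ such that every element of $C\cap\mathbb{Z}^n$ is a non-negative integral combination of its elements. -/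

import Mathlib

/-- The entrywise inclusion of `ℤⁿ` into `ℝⁿ`. -/
def intCastVec (n : ℕ) : (Fin n → ℤ) →+ (Fin n → ℝ) :=
  (Int.castAddHom ℝ).compLeft (Fin n)

/-- `pos {r¹, …, rᵏ}`: all finite non-negative real combinations of the integer vectors `rⁱ`. -/
def posCone {n k : ℕ} (r : Fin k → Fin n → ℤ) : PointedCone ℝ (Fin n → ℝ) :=
  PointedCone.hull ℝ (Set.range fun i => intCastVec n (r i))

/-- The additive monoid `C ∩ ℤⁿ` of integer vectors in the cone `C`. -/
def integerPoints {n : ℕ} (C : PointedCone ℝ (Fin n → ℝ)) : AddSubmonoid (Fin n → ℤ) :=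
  C.toAddSubmonoid.comap (intCastVec n)

/-- `H` consists of integer vectors of `C`, and every integer vector of `C` is a non-negative
integral combination of elements of `H`. -/
def GeneratesIntegerPoints {n : ℕ} (C : PointedCone ℝ (Fin n → ℝ)) (H : Set (Fin n → ℤ)) : Prop :=
  H ⊆ integerPoints C ∧ integerPoints C ≤ AddSubmonoid.closure H

/-- The Hilbert basis of a pointed rational cone `C`: the smallest set of integer vectors in `C`
that generates `C ∩ ℤⁿ` by non-negative integral combinations, obtained as the intersection of all
generating sets. -/
def coneHilbertBasis {n : ℕ} (C : PointedCone ℝ (Fin n → ℝ)) : Set (Fin n → ℤ) :=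
  ⋂₀ {H | GeneratesIntegerPoints C H}

/-- Whenever a smallest generating set exists (it does for every pointed rational cone), it is
`coneHilbertBasis C`. -/
theorem IsLeast.eq_coneHilbertBasis {n : ℕ} {C : PointedCone ℝ (Fin n → ℝ)}
    {H : Set (Fin n → ℤ)} (h : IsLeast {H | GeneratesIntegerPoints C H} H) :
    H = coneHilbertBasis C :=
  Set.Subset.antisymm (Set.subset_sInter fun _ hK => h.2 hK) (Set.sInter_subset_of_mem h.1)

/-- `z = λ₁ h¹ + ⋯ + λₖ hᵏ` with `λᵢ ∈ ℕ` and `hⁱ ∈ H`. -/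
def IsNatCombination {n : ℕ} (H : Set (Fin n → ℤ)) (z : Fin n → ℤ) (k : ℕ) : Prop :=
  ∃ (c : Fin k → ℕ) (h : Fin k → Fin n → ℤ), (∀ i, h i ∈ H) ∧ z = ∑ i, c i • h i

/-- The integer Carathéodory rank of `C`: the maximum over all `z ∈ C ∩ ℤⁿ` of the least `k` such
that `z` is a non-negative integral combination of `k` Hilbert basis elements. It takes values in
`ℕ∞`, so that an upper bound by a natural number says that such a `k` exists for every `z` and that
the maximum is finite. -/
noncomputable def integerCaratheodoryRank {n : ℕ} (C : PointedCone ℝ (Fin n → ℝ)) : ℕ∞ :=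
  ⨆ z ∈ integerPoints C, ⨅ k ∈ {k : ℕ | IsNatCombination (coneHilbertBasis C) z k}, (k : ℕ∞)

/-! Choose an irreducible integer vector `s j` on each ray; let `N` be the lattice they span and `G
= ℤⁿ/N`, a group of order at most `|det r|`. Write `z` as a non-negative combination of the `s j`
plus a multiset `T` of irreducibles, with `T` as small as possible. If distinct members of `T` had a
sum in `N`, that sum would be a non-negative combination of the `s j` and could be absorbed, so `T`
would shrink. An irreducible outside `N` is determined by its class (`irreducible_eq_of_sub_mem`),
so the distinct members of `T` map injectively onto a zero-sum free subset of `G`.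

A zero-sum free set of size `k ≥ 3` has at least `k + 3` subset sums
(`ZeroSumFree.card_add_three_le`), so it has at most `|G| - 3` elements once `|G| ≥ 6`. Together
with the `n` ray vectors this gives the bound. -/

/-! ### Zero-sum free sets in finite abelian groups -/

section ZeroSumFree

open Finset

variable {G : Type*} [AddCommGroup G]

/-- No non-empty subset of `S` has sum zero. -/
def ZeroSumFree (S : Finset G) : Prop :=
  ∀ A ⊆ S, A.Nonempty → ∑ x ∈ A, x ≠ 0

theorem ZeroSumFree.mono {S T : Finset G} (h : ZeroSumFree T) (hST : S ⊆ T) : ZeroSumFree S :=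
  fun A hA => h A (hA.trans hST)

variable [DecidableEq G]

/-- All sums over subsets of `S`, including the empty one. -/
def subsetSums (S : Finset G) : Finset G :=
  S.powerset.image fun A => ∑ x ∈ A, x

theorem sum_mem_subsetSums {S A : Finset G} (h : A ⊆ S) : ∑ x ∈ A, x ∈ subsetSums S :=
  mem_image_of_mem _ (mem_powerset.2 h)

theorem zero_mem_subsetSums (S : Finset G) : (0 : G) ∈ subsetSums S := by
  simpa using sum_mem_subsetSums (empty_subset S)

theorem subsetSums_mono {S T : Finset G} (h : S ⊆ T) : subsetSums S ⊆ subsetSums T :=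
  image_subset_image (powerset_mono.2 h)

/-- If no new sum appeared, translation by `a` would permute the finite set of sums, so some sum
plus `a` would be zero. -/
theorem card_subsetSums_lt_insert {S : Finset G} {a : G} (ha : a ∉ S)
    (h : ZeroSumFree (insert a S)) : #(subsetSums S) < #(subsetSums (insert a S)) := by
  refine card_lt_card (Finset.ssubset_iff_subset_ne.2 ⟨subsetSums_mono (subset_insert a S), fun heq => ?_⟩)
  have hsub : (subsetSums S).image (· + a) ⊆ subsetSums S := by
    intro x hx
    obtain ⟨y, hy, rfl⟩ := mem_image.1 hx
    obtain ⟨A, hA, rfl⟩ := mem_image.1 hy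
    rw [mem_powerset] at hA
    rw [heq, add_comm, ← sum_insert (f := fun x => x) fun haA => ha (hA haA)]
    exact sum_mem_subsetSums (insert_subset_insert a hA)
  have himage := eq_of_subset_of_card_le hsub
    (card_image_of_injective _ (add_left_injective a)).ge
  have hzero := zero_mem_subsetSums S
  rw [← himage] at hzero
  obtain ⟨y, hy, hya⟩ := mem_image.1 hzero
  obtain ⟨A, hA, rfl⟩ := mem_image.1 hy
  rw [mem_powerset] at hA
  refine h _ (insert_subset_insert a hA) (insert_nonempty a A) ?_
  rw [sum_insert fun haA => ha (hA haA), add_comm]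
  exact hya

theorem six_le_card_subsetSums {S : Finset G} (hS : #S = 3) (h : ZeroSumFree S) :
    6 ≤ #(subsetSums S) := by
  obtain ⟨a, b, c, hab, hac, hbc, rfl⟩ := card_eq_three.1 hS
  have ha : a ≠ 0 := by simpa using h {a} (by simp) (by simp)
  have hb : b ≠ 0 := by simpa using h {b} (by simp) (by simp)
  have hc : c ≠ 0 := by simpa using h {c} (by simp) (by simp)
  have hab0 : a + b ≠ 0 := by
    simpa [sum_pair hab] using h {a, b} (by grind) (by simp)
  have hac0 : a + c ≠ 0 := by
    simpa [sum_pair hac] using h {a, c} (by grind) (by simp)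
  have hbc0 : b + c ≠ 0 := by
    simpa [sum_pair hbc] using h {b, c} (by grind) (by simp)
  have habc : ∑ x ∈ ({a, b, c} : Finset G), x = a + (b + c) := by
    rw [sum_insert (by simp [hab, hac]), sum_pair hbc]
  have habc0 : a + (b + c) ≠ 0 := by
    rw [← habc]
    exact h {a, b, c} Subset.rfl (by simp)
  have mem_single (x : G) (hx : x ∈ ({a, b, c} : Finset G)) : x ∈ subsetSums {a, b, c} := by
    simpa using sum_mem_subsetSums (singleton_subset_iff.2 hx)
  have mem_pair (x y : G) (hx : x ∈ ({a, b, c} : Finset G)) (hy : y ∈ ({a, b, c} : Finset G))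
      (hxy : x ≠ y) : x + y ∈ subsetSums {a, b, c} := by
    rw [← sum_pair (f := fun x => x) hxy]
    exact sum_mem_subsetSums (by grind)
  have mem_c := mem_single c (by simp)
  have mem_ac := mem_pair a c (by simp) (by simp) hac
  have mem_bc := mem_pair b c (by simp) (by simp) hbc
  have hsub : ({0, a, b, a + b, a + (b + c)} : Finset G) ⊆ subsetSums {a, b, c} := by
    intro x hx
    simp only [mem_insert, mem_singleton] at hx
    rcases hx with rfl | rfl | rfl | rfl | rfl
    · exact zero_mem_subsetSums _
    · exact mem_single _ (by simp)
    · exact mem_single _ (by simp)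
    · exact mem_pair _ _ (by simp) (by simp) hab
    · rw [← habc]
      exact sum_mem_subsetSums Subset.rfl
  have hb' : b ≠ a + (b + c) := by
    rw [add_left_comm]
    simpa using hac0
  have hab' : a + b ≠ a + (b + c) := by simpa using hc
  have hcard : #({0, a, b, a + b, a + (b + c)} : Finset G) = 5 := by
    rw [card_insert_of_notMem, card_insert_of_notMem, card_insert_of_notMem,
      card_insert_of_notMem, card_singleton] <;>
      simp only [mem_insert, mem_singleton, not_or]
    · exact hab'
    · exact ⟨by simpa using ha, hb'⟩
    · exact ⟨hab, by simpa using hb, by simpa using hbc0⟩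
    · exact ⟨ha.symm, hb.symm, hab0.symm, habc0.symm⟩
  -- With only the five listed sums available, `c`, `a + c` and `b + c` must be among them. This
  -- forces `c = a + b`, `a + c = b` and `b + c = a`, whence `2a = 0 = a + b + c`.
  by_contra! hlt
  have heq := eq_of_subset_of_card_le hsub (by omega)
  rw [← heq] at mem_c mem_ac mem_bc
  simp only [mem_insert, mem_singleton] at mem_c mem_ac mem_bc
  have hcab : c = a + b := by
    rcases mem_c with h | h | h | h | h
    exacts [absurd h hc, absurd h.symm hac, absurd h.symm hbc, h,
      absurd (by rw [← add_assoc] at h; simpa using h) hab0]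
  have hacb : a + c = b := by
    rcases mem_ac with h | h | h | h | h
    exacts [absurd h hac0, absurd (by simpa using h) hc, h, absurd (by simpa using h.symm) hbc,
      absurd (by simpa using h) hb]
  have hbca : b + c = a := by
    rcases mem_bc with h | h | h | h | h
    exacts [absurd h hbc0, h, absurd (by simpa using h) hc,
      absurd (by rw [add_comm b c] at h; simpa using h.symm) hac, absurd (by simpa using h) ha]
  apply habc0
  rw [hbca]
  have hsum : b + (a + a) = b := by
    rw [add_comm b, add_assoc, ← hcab, hacb]
  simpa using hsum

theorem ZeroSumFree.card_add_three_le {S : Finset G} (h : ZeroSumFree S) (hS : 3 ≤ #S) :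
    #S + 3 ≤ #(subsetSums S) := by
  induction S using Finset.induction_on with
  | empty => simp at hS
  | insert a S ha ih =>
    have hcard := card_insert_of_notMem ha
    rcases hS.eq_or_lt with h3 | h3
    · have := six_le_card_subsetSums h3.symm h
      omega
    · have := ih (h.mono (subset_insert a S)) (by omega)
      have := card_subsetSums_lt_insert ha h
      omega

/-- The `6` absorbs sets with fewer than three elements, for which the count of sums says nothing.
-/
theorem ZeroSumFree.card_le [Finite G] {S : Finset G} (h : ZeroSumFree S) :
    #S ≤ max (Nat.card G) 6 - 3 := by
  have := Fintype.ofFinite G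
  rcases le_or_gt 3 (#S) with hS | hS
  · have h1 := h.card_add_three_le hS
    have h2 := card_le_univ (subsetSums S)
    rw [← Nat.card_eq_fintype_card] at h2
    omega
  · omega

end ZeroSumFree

/-! ### Irreducible elements and Hilbert bases -/

/-- A non-zero element of `M` that is not the sum of two non-zero elements of `M`. -/
structure IsIrreducibleIn {n : ℕ} (M : AddSubmonoid (Fin n → ℤ)) (h : Fin n → ℤ) : Prop where
  mem : h ∈ M
  ne_zero : h ≠ 0
  eq_zero_or : ∀ a ∈ M, ∀ b ∈ M, a + b = h → a = 0 ∨ b = 0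

theorem IsIrreducibleIn.mem_coneHilbertBasis {n : ℕ} {C : PointedCone ℝ (Fin n → ℝ)}
    {h : Fin n → ℤ} (hh : IsIrreducibleIn (integerPoints C) h) : h ∈ coneHilbertBasis C := by
  rintro H ⟨hHC, hH⟩
  have key : ∀ x ∈ AddSubmonoid.closure H,
      x ∈ integerPoints C ∧ (IsIrreducibleIn (integerPoints C) x → x ∈ H) := by
    intro x hx
    induction hx using AddSubmonoid.closure_induction with
    | mem x hx => exact ⟨hHC hx, fun _ => hx⟩
    | zero => exact ⟨zero_mem _, fun h0 => absurd rfl h0.ne_zero⟩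
    | add x y _ _ ihx ihy =>
      refine ⟨add_mem ihx.1 ihy.1, fun hxy => ?_⟩
      rcases hxy.eq_zero_or x ihx.1 y ihy.1 rfl with rfl | rfl
      · rw [zero_add] at hxy ⊢
        exact ihy.2 hxy
      · rw [add_zero] at hxy ⊢
        exact ihx.2 hxy
  exact (key h (hH hh.mem)).2 hh

/-- `M` is the set of vectors on which the injective integral linear map `φ` is non-negative. -/
structure IsNonnegLocus {n : ℕ} (M : AddSubmonoid (Fin n → ℤ))
    (φ : (Fin n → ℤ) →+ (Fin n → ℤ)) : Prop where
  mem_iff : ∀ z, z ∈ M ↔ 0 ≤ φ z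
  injective : Function.Injective φ

namespace IsNonnegLocus

variable {n : ℕ} {M : AddSubmonoid (Fin n → ℤ)} {φ : (Fin n → ℤ) →+ (Fin n → ℤ)}

theorem sum_pos (hM : IsNonnegLocus M φ) {z : Fin n → ℤ} (hz : z ∈ M) (h0 : z ≠ 0) :
    0 < ∑ i, φ z i := by
  have hnn := (hM.mem_iff z).1 hz
  refine (Finset.sum_nonneg fun i _ => hnn i).lt_of_ne fun hsum => h0 (hM.injective ?_)
  rw [map_zero]
  funext i
  exact (Finset.sum_eq_zero_iff_of_nonneg fun i _ => hnn i).1 hsum.symm i (Finset.mem_univ i)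

/-- The coordinate sum of `φ z` is a height: it is positive on non-zero elements, so splitting
strictly lowers it. -/
theorem exists_multiset (hM : IsNonnegLocus M φ) {z : Fin n → ℤ} (hz : z ∈ M) :
    ∃ T : Multiset (Fin n → ℤ), (∀ h ∈ T, IsIrreducibleIn M h) ∧ T.sum = z := by
  induction hk : (∑ i, φ z i).toNat using Nat.strong_induction_on generalizing z with
  | _ k ih =>
    by_cases h0 : z = 0
    · exact ⟨0, by simp, by simp [h0]⟩
    by_cases hirr : IsIrreducibleIn M z
    · exact ⟨{z}, by simpa using hirr, by simp⟩
    obtain ⟨a, ha, b, hb, hab, ha0, hb0⟩ :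
        ∃ a ∈ M, ∃ b ∈ M, a + b = z ∧ a ≠ 0 ∧ b ≠ 0 := by
      by_contra! hno
      exact hirr ⟨hz, h0, fun a ha b hb hab => or_iff_not_imp_left.2 (hno a ha b hb hab)⟩
    have hsum : ∑ i, φ z i = ∑ i, φ a i + ∑ i, φ b i := by
      rw [← hab, map_add, ← Finset.sum_add_distrib]
      rfl
    have hpa := hM.sum_pos ha ha0
    have hpb := hM.sum_pos hb hb0
    obtain ⟨T, hT, rfl⟩ := ih _ (by omega) ha rfl
    obtain ⟨U, hU, rfl⟩ := ih _ (by omega) hb rfl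
    refine ⟨T + U, fun h hh => ?_, by rw [Multiset.sum_add, hab]⟩
    rcases Multiset.mem_add.1 hh with hh | hh
    exacts [hT h hh, hU h hh]

theorem exists_irreducible_on_ray (hM : IsNonnegLocus M φ) {r : Fin n → ℤ} {j : Fin n} {d : ℤ}
    (hd : 0 < d) (hr : φ r = Pi.single j d) :
    ∃ s t, IsIrreducibleIn M s ∧ φ s = Pi.single j t ∧ 0 < t ∧ t ≤ d := by
  have hrM : r ∈ M := by
    rw [hM.mem_iff, hr]
    exact Pi.single_nonneg.2 hd.le
  obtain ⟨T, hT, hsum⟩ := hM.exists_multiset hrM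
  have hT0 : T ≠ 0 := by
    rintro rfl
    rw [← hsum, Multiset.sum_zero, map_zero] at hr
    have := congr_fun hr j
    simp at this
    omega
  obtain ⟨s, hs⟩ := Multiset.exists_mem_of_ne_zero hT0
  obtain ⟨U, rfl⟩ := Multiset.exists_cons_of_mem hs
  have hU : 0 ≤ φ U.sum := (hM.mem_iff _).1
    (AddSubmonoid.multiset_sum_mem _ _ fun x hx => (hT x (Multiset.mem_cons_of_mem hx)).mem)
  have hirr := hT s hs
  have hs0 : 0 ≤ φ s := (hM.mem_iff _).1 hirr.mem
  have hadd : φ s + φ U.sum = Pi.single j d := by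
    rw [← map_add, ← Multiset.sum_cons, hsum, hr]
  -- Off `j`, two non-negative coordinates add up to zero.
  have hsj : φ s = Pi.single j (φ s j) := by
    funext i
    rcases eq_or_ne i j with rfl | hij
    · simp
    · have h1 := congr_fun hadd i
      have h2 := hs0 i
      have h3 := hU i
      simp only [Pi.add_apply, Pi.single_eq_of_ne hij, Pi.zero_apply] at h1 h2 h3 ⊢
      omega
  have hpos := hM.sum_pos hirr.mem hirr.ne_zero
  rw [hsj, Finset.sum_pi_single' j (φ s j) Finset.univ] at hpos
  refine ⟨s, φ s j, hirr, hsj, by simpa using hpos, ?_⟩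
  have h1 := congr_fun hadd j
  have h3 := hU j
  simp only [Pi.add_apply, Pi.single_eq_same, Pi.zero_apply] at h1 h3
  omega

section Rays

variable {s : Fin n → Fin n → ℤ} {t : Fin n → ℤ}

theorem apply_sum_smul (hs : ∀ j, φ (s j) = Pi.single j (t j)) (c : Fin n → ℤ) (i : Fin n) :
    φ (∑ j, c j • s j) i = c i * t i := by
  simp only [map_sum, map_zsmul, hs, Finset.sum_apply, Pi.smul_apply, Pi.single_apply,
    smul_eq_mul, mul_ite, mul_zero, Finset.sum_ite_eq, Finset.mem_univ, if_true]

/-- Lattice points of `M` in the lattice of the `s j` are non-negative combinations. -/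
theorem exists_nat_combination (hM : IsNonnegLocus M φ) (hs : ∀ j, φ (s j) = Pi.single j (t j))
    (ht : ∀ j, 0 < t j) {z : Fin n → ℤ} (hz : z ∈ M)
    (hzs : z ∈ Submodule.span ℤ (Set.range s)) : ∃ c : Fin n → ℕ, ∑ j, c j • s j = z := by
  obtain ⟨c, rfl⟩ := (Submodule.mem_span_range_iff_exists_fun ℤ).1 hzs
  have hc : ∀ j, 0 ≤ c j := fun j => by
    have := (hM.mem_iff _).1 hz j
    rw [apply_sum_smul hs] at this
    exact nonneg_of_mul_nonneg_left this (ht j)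
  refine ⟨fun j => (c j).toNat, Finset.sum_congr rfl fun j _ => ?_⟩
  rw [← natCast_zsmul, Int.toNat_of_nonneg (hc j)]

/-- Irreducible elements outside the lattice of the rays are determined by their residue class. -/
theorem irreducible_eq_of_sub_mem (hM : IsNonnegLocus M φ)
    (hs : ∀ j, φ (s j) = Pi.single j (t j)) (ht : ∀ j, 0 < t j) {g h : Fin n → ℤ}
    (hg : IsIrreducibleIn M g) (hh : IsIrreducibleIn M h)
    (hg' : g ∉ Submodule.span ℤ (Set.range s)) (hh' : h ∉ Submodule.span ℤ (Set.range s))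
    (hgh : g - h ∈ Submodule.span ℤ (Set.range s)) : g = h := by
  have key : ∀ g h : Fin n → ℤ, IsIrreducibleIn M g → IsIrreducibleIn M h →
      g ∉ Submodule.span ℤ (Set.range s) → ∀ c : Fin n → ℤ, ∑ j, c j • s j = g - h →
      ∀ j, c j ≤ 0 := by
    intro g h hg hh hg' c hc j
    by_contra! hj
    have hsM : s j ∈ M := by
      rw [hM.mem_iff, hs]
      exact Pi.single_nonneg.2 (ht j).le
    -- A positive `c j` makes the `j`-th coordinate of `g` at least `t j`, so `s j` splits off,
    -- contradicting irreducibility of `g`.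
    have hsub : g - s j ∈ M := by
      rw [hM.mem_iff]
      intro i
      have hhi := (hM.mem_iff _).1 hh.mem i
      have hgi := (hM.mem_iff _).1 hg.mem i
      have hi := apply_sum_smul hs c i
      rw [hc] at hi
      rw [map_sub, hs]
      rw [map_sub] at hi
      simp only [Pi.sub_apply, Pi.zero_apply] at hi hhi hgi ⊢
      rcases eq_or_ne i j with rfl | hij
      · rw [Pi.single_eq_same]
        have := ht i
        nlinarith
      · rw [Pi.single_eq_of_ne hij]
        omega
    have hsj : s j ∈ Submodule.span ℤ (Set.range s) := Submodule.subset_span ⟨j, rfl⟩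
    rcases hg.eq_zero_or _ hsub _ hsM (sub_add_cancel _ _) with h0 | h0
    · exact hg' (by rwa [sub_eq_zero.1 h0])
    · have := congr_fun (hs j) j
      rw [h0, map_zero, Pi.single_eq_same] at this
      exact (ht j).ne this
  obtain ⟨c, hc⟩ := (Submodule.mem_span_range_iff_exists_fun ℤ).1 hgh
  have hle := key g h hg hh hg' c hc
  have hge := key h g hh hg hh' (-c) (by
    simp only [Pi.neg_apply, neg_smul, Finset.sum_neg_distrib, hc, neg_sub])
  have hc0 : c = 0 := funext fun j => le_antisymm (hle j) (by simpa using hge j)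
  rw [hc0] at hc
  simpa [eq_comm, sub_eq_zero] using hc

end Rays

end IsNonnegLocus

/-! ### Representations with few Hilbert basis elements -/

theorem IsNatCombination.of_fintype {n : ℕ} {H : Set (Fin n → ℤ)} {ι : Type*} [Fintype ι]
    (c : ι → ℕ) (h : ι → Fin n → ℤ) (hh : ∀ i, h i ∈ H) :
    IsNatCombination H (∑ i, c i • h i) (Fintype.card ι) :=
  ⟨c ∘ (Fintype.equivFin ι).symm, h ∘ (Fintype.equivFin ι).symm, fun _ => hh _,
    ((Fintype.equivFin ι).symm.sum_comp fun i => c i • h i).symm⟩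

theorem IsNonnegLocus.exists_sum_add_sum {n : ℕ} {M : AddSubmonoid (Fin n → ℤ)}
    {φ : (Fin n → ℤ) →+ (Fin n → ℤ)} (hM : IsNonnegLocus M φ) {s : Fin n → Fin n → ℤ}
    {t : Fin n → ℤ} (hs : ∀ j, φ (s j) = Pi.single j (t j)) (ht : ∀ j, 0 < t j)
    [Finite ((Fin n → ℤ) ⧸ Submodule.span ℤ (Set.range s))] {z : Fin n → ℤ} (hz : z ∈ M) :
    ∃ (c : Fin n → ℕ) (S : Finset (Fin n → ℤ)) (m : (Fin n → ℤ) → ℕ),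
      (∀ h ∈ S, IsIrreducibleIn M h) ∧ z = ∑ j, c j • s j + ∑ h ∈ S, m h • h ∧
      S.card ≤ max (Nat.card ((Fin n → ℤ) ⧸ Submodule.span ℤ (Set.range s))) 6 - 3 := by
  classical
  set N := Submodule.span ℤ (Set.range s) with hN
  have hex : ∃ k, ∃ (T : Multiset (Fin n → ℤ)) (c : Fin n → ℕ), T.card = k ∧
      (∀ h ∈ T, IsIrreducibleIn M h) ∧ z = ∑ j, c j • s j + T.sum := by
    obtain ⟨T, hT, hsum⟩ := hM.exists_multiset hz
    exact ⟨_, T, 0, rfl, hT, by simp [hsum]⟩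
  obtain ⟨T, c, hcard, hT, hsum⟩ := Nat.find_spec hex
  have hfree : ∀ B ⊆ T.toFinset, B.Nonempty → ∑ x ∈ B, x ∉ N := by
    intro B hB hne hBN
    -- One copy of each element of `B` is removed from `T`, and their sum moves into the ray
    -- coefficients.
    have hBT : B.val ≤ T := (Multiset.le_iff_subset B.nodup).2 fun x hx =>
      Multiset.mem_toFinset.1 (hB hx)
    obtain ⟨U, rfl⟩ := Multiset.le_iff_exists_add.1 hBT
    have hBM : ∑ x ∈ B, x ∈ M :=
      sum_mem fun x hx => (hT x (Multiset.mem_add.2 (Or.inl hx))).mem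
    obtain ⟨c', hc'⟩ := hM.exists_nat_combination hs ht hBM hBN
    refine Nat.find_min hex (m := U.card) ?_ ⟨U, c + c', rfl,
      fun h hh => hT h (Multiset.mem_add.2 (Or.inr hh)), ?_⟩
    · rw [← hcard, Multiset.card_add]
      have := hne.card_pos
      rw [Finset.card_def] at this
      omega
    · rw [hsum, Multiset.sum_add, Finset.sum_val, ← add_assoc]
      congr 1
      simp only [Pi.add_apply, add_smul, Finset.sum_add_distrib, hc']
      rfl
  have hnot : ∀ x ∈ T, x ∉ N := fun x hx => by
    simpa using hfree {x} (by simpa using hx) (by simp)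
  have hinj : Set.InjOn N.mkQ (T.toFinset : Set (Fin n → ℤ)) := by
    intro x hx y hy hxy
    have hx' : x ∈ T := by simpa using hx
    have hy' : y ∈ T := by simpa using hy
    exact hM.irreducible_eq_of_sub_mem hs ht (hT x hx') (hT y hy') (hnot x hx') (hnot y hy')
      ((Submodule.Quotient.eq N).1 hxy)
  have hzero : ZeroSumFree (T.toFinset.image N.mkQ) := by
    intro A hA hne h0
    obtain ⟨B, hB, rfl⟩ := Finset.subset_image_iff.1 hA
    rw [Finset.sum_image (hinj.mono hB), ← map_sum] at h0
    exact hfree B hB (Finset.image_nonempty.1 hne) ((Submodule.Quotient.mk_eq_zero N).1 h0)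
  refine ⟨c, T.toFinset, fun h => T.count h, fun h hh => hT h (Multiset.mem_toFinset.1 hh), ?_, ?_⟩
  · rw [hsum, Finset.sum_multiset_count]
  · rw [← Finset.card_image_of_injOn hinj]
    exact hzero.card_le

/-! ### Coordinates of a simplicial cone -/

theorem mem_posCone_iff {n k : ℕ} (r : Fin k → Fin n → ℤ) (x : Fin n → ℝ) :
    x ∈ posCone r ↔
      ∃ c : Fin k → ℝ, 0 ≤ c ∧ x = ((Matrix.of r).transpose.map (Int.cast : ℤ → ℝ)).mulVec c := by
  have hcomb (c : Fin k → ℝ) : ((Matrix.of r).transpose.map (Int.cast : ℤ → ℝ)).mulVec c =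
      ∑ i, c i • intCastVec n (r i) := by
    funext j
    simp [Matrix.mulVec, dotProduct, intCastVec, mul_comm]
  unfold posCone PointedCone.hull
  rw [Submodule.mem_span_range_iff_exists_fun]
  constructor
  · rintro ⟨c, rfl⟩
    refine ⟨fun i => c i, fun i => (c i).2, ?_⟩
    rw [hcomb]
    rfl
  · rintro ⟨c, hc, rfl⟩
    refine ⟨fun i => ⟨c i, hc i⟩, ?_⟩
    rw [hcomb]
    rfl

theorem exists_isNonnegLocus {n : ℕ} (r : Fin n → Fin n → ℤ)
    (hdet : (Matrix.of r).transpose.det ≠ 0) :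
    ∃ φ, IsNonnegLocus (integerPoints (posCone r)) φ ∧
      ∀ j, φ (r j) = Pi.single j |(Matrix.of r).transpose.det| := by
  set A := (Matrix.of r).transpose with hA
  -- The sign makes `B` a positive multiple of the inverse of `A`, so non-negativity is preserved.
  set B : Matrix (Fin n) (Fin n) ℤ := A.det.sign • A.adjugate with hB
  have hBA : B * A = |A.det| • (1 : Matrix (Fin n) (Fin n) ℤ) := by
    rw [hB, Matrix.smul_mul, Matrix.adjugate_mul, smul_smul, Int.sign_mul_self_eq_abs]
  have hAB : A * B = |A.det| • (1 : Matrix (Fin n) (Fin n) ℤ) := by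
    rw [hB, Matrix.mul_smul, Matrix.mul_adjugate, smul_smul, Int.sign_mul_self_eq_abs]
  have hpos : 0 < |A.det| := abs_pos.2 hdet
  have hposR : (0 : ℝ) < (|A.det| : ℤ) := by exact_mod_cast hpos
  have hcast (X : Matrix (Fin n) (Fin n) ℤ) (z : Fin n → ℤ) : (X.map (Int.cast : ℤ → ℝ)).mulVec
      (intCastVec n z) = intCastVec n (X.mulVec z) := by
    funext i
    simp [Matrix.mulVec, dotProduct, intCastVec]
  have hmul (X Y : Matrix (Fin n) (Fin n) ℤ) : (X * Y).map (Int.cast : ℤ → ℝ) =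
      X.map (Int.cast : ℤ → ℝ) * Y.map (Int.cast : ℤ → ℝ) :=
    Matrix.map_mul (f := Int.castRingHom ℝ)
  have hone : (|A.det| • (1 : Matrix (Fin n) (Fin n) ℤ)).map (Int.cast : ℤ → ℝ) =
      ((|A.det| : ℤ) : ℝ) • (1 : Matrix (Fin n) (Fin n) ℝ) := by
    ext i j
    rw [Matrix.map_apply, Matrix.smul_apply, Matrix.smul_apply, smul_eq_mul, smul_eq_mul,
      Int.cast_mul, Matrix.one_apply, Matrix.one_apply]
    split_ifs <;> simp
  refine ⟨B.mulVecLin.toAddMonoidHom, ⟨fun z => ?_, ?_⟩, fun j => ?_⟩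
  · change intCastVec n z ∈ posCone r ↔ 0 ≤ B.mulVec z
    have hnonneg : 0 ≤ B.mulVec z ↔ 0 ≤ (B.map (Int.cast : ℤ → ℝ)).mulVec (intCastVec n z) := by
      rw [hcast]
      simp [Pi.le_def, intCastVec]
    rw [mem_posCone_iff, hnonneg]
    constructor
    · rintro ⟨c, hc, hz⟩
      rw [hz, Matrix.mulVec_mulVec, ← hmul, hBA, hone, Matrix.smul_mulVec, Matrix.one_mulVec]
      exact smul_nonneg hposR.le hc
    · intro h
      refine ⟨((|A.det| : ℤ) : ℝ)⁻¹ • (B.map (Int.cast : ℤ → ℝ)).mulVec (intCastVec n z),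
        smul_nonneg (inv_nonneg.2 hposR.le) h, ?_⟩
      rw [Matrix.mulVec_smul, Matrix.mulVec_mulVec, ← hmul, hAB, hone, Matrix.smul_mulVec,
        Matrix.one_mulVec, inv_smul_smul₀ hposR.ne']
  · intro x y hxy
    have h := congr_arg A.mulVec (show B.mulVec x = B.mulVec y from hxy)
    rw [Matrix.mulVec_mulVec, Matrix.mulVec_mulVec, hAB, Matrix.smul_mulVec, Matrix.smul_mulVec,
      Matrix.one_mulVec, Matrix.one_mulVec] at h
    exact smul_right_injective _ hpos.ne' h
  · change B.mulVec (r j) = _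
    have hcol : r j = A.mulVec (Pi.single j 1) := by
      rw [Matrix.mulVec_single_one]
      rfl
    rw [hcol, Matrix.mulVec_mulVec, hBA, Matrix.smul_mulVec, Matrix.one_mulVec]
    funext i
    simp [Pi.single_apply]

/-- A full rank sublattice of `ℤⁿ` has index the absolute value of its determinant. -/
theorem card_quotient_span_range {n : ℕ} (s : Fin n → Fin n → ℤ) (hdet : (Matrix.of s).det ≠ 0) :
    Nat.card ((Fin n → ℤ) ⧸ Submodule.span ℤ (Set.range s)) = (Matrix.of s).det.natAbs := by
  have hli : LinearIndependent ℤ s := Matrix.linearIndependent_rows_of_det_ne_zero hdet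
  rw [← Submodule.natAbs_det_basis_change (Pi.basisFun ℤ (Fin n)) _ (Module.Basis.span hli)]
  congr 1
  rw [← Matrix.det_transpose, Module.Basis.det_apply]
  congr 1
  ext i j
  simp [Module.Basis.toMatrix_apply, Module.Basis.span_apply]

/-- Shortening the generators of a simplicial cone does not increase the determinant. -/
theorem det_ne_zero_and_natAbs_det_le {n : ℕ} {r s : Fin n → Fin n → ℤ} {d : ℤ} {t : Fin n → ℤ}
    (hd : 0 < d) (ht : ∀ j, 0 < t j) (htd : ∀ j, t j ≤ d) (hrs : ∀ j, d • s j = t j • r j)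
    (hr : (Matrix.of r).det ≠ 0) :
    (Matrix.of s).det ≠ 0 ∧ (Matrix.of s).det.natAbs ≤ (Matrix.of r).det.natAbs := by
  have h1 : (∏ _j : Fin n, d) * (Matrix.of s).det = (∏ j, t j) * (Matrix.of r).det := by
    rw [← Matrix.det_mul_column, ← Matrix.det_mul_column]
    congr 1
    ext i j
    exact congr_fun (hrs i) j
  have hprod : 0 < ∏ j, t j := Finset.prod_pos fun j _ => ht j
  have hdn : 0 < ∏ _j : Fin n, d := Finset.prod_pos fun _ _ => hd
  have hle : ∏ j, t j ≤ ∏ _j : Fin n, d :=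
    Finset.prod_le_prod (fun j _ => (ht j).le) fun j _ => htd j
  constructor
  · intro h0
    rw [h0, mul_zero] at h1
    exact mul_ne_zero hprod.ne' hr h1.symm
  · have h2 := congr_arg abs h1
    rw [abs_mul, abs_mul, abs_of_pos hdn, abs_of_pos hprod] at h2
    have h3 := mul_le_mul_of_nonneg_right hle (abs_nonneg (Matrix.of r).det)
    rw [← h2] at h3
    have h4 := le_of_mul_le_mul_left h3 hdn
    rw [Int.abs_eq_natAbs, Int.abs_eq_natAbs] at h4
    exact_mod_cast h4

/-! ### The rank bound -/

theorem theorem2 (n : ℕ) (r : Fin n → Fin n → ℤ)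
    (hlower : 6 ≤ (Matrix.of r).transpose.det.natAbs)
    (hupper : (Matrix.of r).transpose.det.natAbs ≤ n) :
    integerCaratheodoryRank (posCone r) ≤
      ((n + (Matrix.of r).transpose.det.natAbs - 3 : ℕ) : ℕ∞) := by
  have hdet : (Matrix.of r).transpose.det ≠ 0 := fun h => by simp [h] at hlower
  have hd : 0 < |(Matrix.of r).transpose.det| := abs_pos.2 hdet
  obtain ⟨φ, hM, hr⟩ := exists_isNonnegLocus r hdet
  choose s t hirr hs ht htd using fun j => hM.exists_irreducible_on_ray hd (hr j)
  obtain ⟨hdets, hle⟩ := det_ne_zero_and_natAbs_det_le (r := r) (s := s) hd ht htd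
    -- Under `φ` both sides become `d * t j` in coordinate `j`.
    (fun j => hM.injective (by
      rw [map_zsmul, map_zsmul, hs, hr, ← Pi.single_smul, ← Pi.single_smul, smul_eq_mul,
        smul_eq_mul, mul_comm]))
    (by rwa [← Matrix.det_transpose])
  have hcard := card_quotient_span_range s hdets
  have : Finite ((Fin n → ℤ) ⧸ Submodule.span ℤ (Set.range s)) :=
    Nat.finite_of_card_ne_zero (by rw [hcard]; exact Int.natAbs_ne_zero.2 hdets)
  refine iSup₂_le fun z hz => ?_
  obtain ⟨c, S, m, hS, hzS, hScard⟩ := hM.exists_sum_add_sum hs ht hz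
  have hcomb := IsNatCombination.of_fintype (H := coneHilbertBasis (posCone r))
    (Sum.elim c fun h : S => m h) (Sum.elim s fun h : S => h)
    (by
      rintro (j | h)
      exacts [(hirr j).mem_coneHilbertBasis, (hS h h.2).mem_coneHilbertBasis])
  rw [Fintype.sum_sum_type] at hcomb
  simp only [Sum.elim_inl, Sum.elim_inr] at hcomb
  rw [Finset.sum_coe_sort S fun h => m h • h, ← hzS, Fintype.card_sum, Fintype.card_fin,
    Fintype.card_coe] at hcomb
  refine (iInf₂_le _ hcomb).trans (Nat.cast_le.2 ?_)
  rw [hcard] at hScard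
  rw [Matrix.det_transpose] at hlower ⊢
  -- Here `6 ≤ |det r|` replaces `max |G| 6` by `|det r|`.
  omega
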